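/- Let $n,m\ge 0$ and let $x_1,\dots,x_n,\ y_1,\dots,y_n,\ z_1,\dots,z_m,\ w_1,\dots,w_m$ be indeterminates. Define $h_r[\boldsymbol x|\boldsymbol y]$ ($r\in\mathbb Z$) by $$\sum_{r\ge 0} h_r[\boldsymbol x|\boldsymbol y]\,t^r=\prod_{i=1}^{n}\frac{1+y_it}{1-x_it},\qquad h_r[\boldsymbol x|\boldsymbol y]=0\ \text{ for } r<0,$$ and, for partitions $\lambda,\mu$ padded by trailing zeros to a common length $\ell$, define the skew supersymmetric Schur function $$s_{\lambda/\mu}[\boldsymbol x|\boldsymbol y]=\det_{1\le i,j\le \ell} h_{\lambda_i-\mu_j-i+j}[\boldsymbol x|\boldsymbol y];$$ $s_{\lambda/\mu}[\boldsymbol z|\boldsymbol w]$ is defined in the same way, with $m$ in place of $n$. **Proposition (Cauchy identity).** For any partitions $\lambda$ and $\mu$, $$\sum_\nu s_{\lambda/\nu}[\boldsymbol x|\boldsymbol y]\,s_{\mu/\nu}[\boldsymbol z|\boldsymbol w]=\prod_{i=1}^{n}\prod_{j=1}^{m}\frac{(1-x_iz_j)(1-y_iw_j)}{(1+x_iw_j)(1+y_iz_j)}\cdot\sum_\nu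 s_{\nu/\mu}[\boldsymbol x|\boldsymbol y]\,s_{\nu/\lambda}[\boldsymbol z|\boldsymbol w]$$ as an identity of formal power series over $\mathbb C$ in all the variables, where both sums run over all partitions $\nu$ (partitions that differ only by trailing zeros being identified). In both sums each monomial occurs in only finitely many terms, so that the sums are well defined. -/

import Mathlib

/-- The supersymmetric complete homogeneous function `h_r[x|y]`, `r ∈ ℤ`, in `x₁, …, x_n` and
`y₁, …, y_n`, i.e. the coefficient of `t ^ r` in `∏ (1 + y_j t) / ∏ (1 - x_i t)`:
`h_r[x|y] = ∑_{a + b = r} h_a(x) e_b(y)` for `r ≥ 0`, and `h_r[x|y] = 0` for `r < 0`. -/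
noncomputable def superH {R : Type*} [CommRing R] {n : ℕ} (x y : Fin n → R) (r : ℤ) : R :=
  if r < 0 then 0
  else ∑ p ∈ Finset.HasAntidiagonal.antidiagonal r.toNat,
    MvPolynomial.aeval x (MvPolynomial.hsymm (Fin n) ℤ p.1) *
      MvPolynomial.aeval y (MvPolynomial.esymm (Fin n) ℤ p.2)

/-- The skew supersymmetric Schur function `s_{α/β}[x|y]`: the Jacobi-Trudi determinant
`det (h_{α_i - β_j - i + j}[x|y])` of size `ℓ`, where the partitions `α` and `β` (the row lengths
of Young diagrams) are padded by trailing zeros to the common length `ℓ = max (ℓ(α), ℓ(β))`. -/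
noncomputable def superSchur {R : Type*} [CommRing R] {n : ℕ} (α β : YoungDiagram)
    (x y : Fin n → R) : R :=
  Matrix.det (Matrix.of fun i j : Fin (max (α.colLen 0) (β.colLen 0)) =>
    superH x y ((α.rowLen i : ℤ) - (β.rowLen j : ℤ) - (i : ℤ) + (j : ℤ)))

/-- A family of formal power series is formally summable if each monomial occurs in only
finitely many members of the family. -/
def FormallySummable {ι σ R : Type*} [CommRing R] (f : ι → MvPowerSeries σ R) : Prop :=
  ∀ d : σ →₀ ℕ, {k : ι | MvPowerSeries.coeff d (f k) ≠ 0}.Finite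

/-- The coefficientwise sum of a (formally summable) family of formal power series. -/
noncomputable def formalSum {ι σ R : Type*} [CommRing R] (f : ι → MvPowerSeries σ R) :
    MvPowerSeries σ R :=
  fun d => ∑ᶠ k, MvPowerSeries.coeff d (f k)

/-- The variables `x₁, …, x_n, y₁, …, y_n, z₁, …, z_m, w₁, …, w_m`. -/
inductive CauchyVar (n m : ℕ) : Type
  | x (i : Fin n) : CauchyVar n m
  | y (i : Fin n) : CauchyVar n m
  | z (j : Fin m) : CauchyVar n m
  | w (j : Fin m) : CauchyVar n m

/-- The ring of formal power series over `ℂ` in the variables `x_i`, `y_i`, `z_j`, `w_j`. -/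
abbrev CauchySeries (n m : ℕ) : Type := MvPowerSeries (CauchyVar n m) ℂ

/-- The family of the variables `x_i` in the power series ring. -/
noncomputable def xVar (n m : ℕ) (i : Fin n) : CauchySeries n m :=
  MvPowerSeries.X (CauchyVar.x i)

/-- The family of the variables `y_i` in the power series ring. -/
noncomputable def yVar (n m : ℕ) (i : Fin n) : CauchySeries n m :=
  MvPowerSeries.X (CauchyVar.y i)

/-- The family of the variables `z_j` in the power series ring. -/
noncomputable def zVar (n m : ℕ) (j : Fin m) : CauchySeries n m :=
  MvPowerSeries.X (CauchyVar.z j)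

/-- The family of the variables `w_j` in the power series ring. -/
noncomputable def wVar (n m : ℕ) (j : Fin m) : CauchySeries n m :=
  MvPowerSeries.X (CauchyVar.w j)

/-!
The function `s_{α/β}` depends on the alphabets only through the generating series `F` of the `h_r`,
and Cauchy–Binet makes it multiplicative: the operators `f ↦ (α ↦ ∑ ν, s_{α/ν} f(ν))` attached to
`F` and `G` compose to the one attached to `F * G`. Hence the validity of the Cauchy identity for
series `F` and `H` is preserved by products, in either argument, with the kernels multiplying, and
by passing from `F` to its inverse, with the kernel inverted. Since `1 + y t` is the inverse of
`1 / (1 - (-y) t)`, everything reduces to `F = 1 + y t` and `H = 1 / (1 - z t)`. There Cauchy–Binet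
writes both sums, cut off at a large rectangle, as determinants of matrices whose rows agree except
for the last one, which differs by the factor `1 + y z`.
-/

namespace SkewCauchy

open Finset

section CauchyBinet

variable {R : Type*} [CommRing R]

lemma exists_orderEmb_comp_perm_eq {N : ℕ} {κ : Type*} [LinearOrder κ] {f : Fin N → κ}
    (hf : Function.Injective f) :
    ∃ (s : Fin N ↪o κ) (σ : Equiv.Perm (Fin N)), s ∘ σ = f := by
  have hsorted : StrictMono (f ∘ Tuple.sort f) :=
    (Tuple.monotone_sort f).strictMono_of_injective (hf.comp (Tuple.sort f).injective)
  exact ⟨OrderEmbedding.ofStrictMono _ hsorted, (Tuple.sort f).symm, by ext; simp⟩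

lemma orderEmb_comp_perm_injective {N : ℕ} {κ : Type*} [LinearOrder κ] :
    Function.Injective fun p : (Fin N ↪o κ) × Equiv.Perm (Fin N) => p.1 ∘ p.2 := by
  rintro ⟨s, σ⟩ ⟨t, τ⟩ (h : s ∘ σ = t ∘ τ)
  have hrange : Set.range s = Set.range t := by
    rw [← EquivLike.range_comp s σ, h, EquivLike.range_comp]
  obtain rfl : s = t := OrderEmbedding.range_inj.mp hrange
  obtain rfl : σ = τ := Equiv.ext fun i => s.injective (congrFun h i)
  rfl

lemma det_mul_transpose_eq_sum_det_submatrix_mul_prod {n κ : Type*} [Fintype n] [DecidableEq n]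
    [Fintype κ] (A B : Matrix n κ R) :
    (A * B.transpose).det = ∑ f : n → κ, (A.submatrix id f).det * ∏ i, B i (f i) := by
  classical
  simp only [Matrix.det_apply', Matrix.mul_apply, prod_univ_sum, mul_sum, Fintype.piFinset_univ]
  rw [sum_comm]
  simp only [sum_mul, prod_mul_distrib, Matrix.submatrix_apply, id, Matrix.transpose_apply,
    mul_assoc]

lemma det_submatrix_mul_det_submatrix {n κ : Type*} [Fintype n] [DecidableEq n]
    (A B : Matrix n κ R) (s : n → κ) :
    (A.submatrix id s).det * (B.submatrix id s).det =
      ∑ σ : Equiv.Perm n, (A.submatrix id (s ∘ σ)).det * ∏ i, B i (s (σ i)) := by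
  rw [← Matrix.det_transpose (B.submatrix id s),
    Matrix.det_apply' (B.submatrix id s).transpose, mul_sum]
  refine sum_congr rfl fun σ _ => ?_
  have hperm : (A.submatrix id (s ∘ σ)).det =
      (Equiv.Perm.sign σ : R) * (A.submatrix id s).det := Matrix.det_permute' σ (A.submatrix id s)
  simp only [hperm, Matrix.submatrix_apply, id, Matrix.transpose_apply]
  ring

/-- The **Cauchy–Binet formula**; an order embedding `s` encodes the choice of `N` columns. -/
theorem det_mul_transpose_eq_sum_det_submatrix {N : ℕ} {κ : Type*} [Fintype κ] [LinearOrder κ]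
    (A B : Matrix (Fin N) κ R) :
    (A * B.transpose).det =
      ∑ s : Fin N ↪o κ, (A.submatrix id s).det * (B.submatrix id s).det := by
  rw [det_mul_transpose_eq_sum_det_submatrix_mul_prod]
  simp only [det_submatrix_mul_det_submatrix]
  rw [← Fintype.sum_prod_type']
  symm
  refine Fintype.sum_of_injective _ orderEmb_comp_perm_injective _ _ (fun f hf => ?_)
    (fun _ => rfl)
  have hnot_inj : ¬ Function.Injective f := fun hinj =>
    let ⟨s, σ, h⟩ := exists_orderEmb_comp_perm_eq hinj
    hf ⟨(s, σ), h⟩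
  obtain ⟨i, j, hij, hne⟩ := Function.not_injective_iff.mp hnot_inj
  rw [Matrix.det_zero_of_column_eq hne (fun k => by simp [hij]), zero_mul]

end CauchyBinet

section Diagrams

noncomputable instance : LocallyFiniteOrderBot YoungDiagram :=
  have hinj : Function.Injective YoungDiagram.cells := fun _ _ => YoungDiagram.ext
  have := Classical.decEq YoungDiagram
  LocallyFiniteOrderBot.ofIic _ (fun μ => μ.cells.powerset.preimage _ hinj.injOn)
    (by simp)

/-- The Young diagram with `N` rows of length `M`. -/
def rectDiagram (N M : ℕ) : YoungDiagram :=
  YoungDiagram.ofRowLens (List.replicate N M)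
    (List.pairwise_replicate_of_refl (R := (· ≥ ·))).sortedGE

lemma mem_rectDiagram {N M : ℕ} {c : ℕ × ℕ} : c ∈ rectDiagram N M ↔ c.1 < N ∧ c.2 < M := by
  simp [rectDiagram, YoungDiagram.mem_ofRowLens]

variable {μ ν : YoungDiagram}

lemma le_iff_rowLen_le : μ ≤ ν ↔ ∀ i, μ.rowLen i ≤ ν.rowLen i := by
  constructor
  · intro h i
    by_contra! hlt
    exact lt_irrefl _ (YoungDiagram.mem_iff_lt_rowLen.mp
      (h (YoungDiagram.mem_iff_lt_rowLen.mpr hlt)))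
  · rintro h ⟨i, j⟩ hc
    exact YoungDiagram.mem_iff_lt_rowLen.mpr
      ((YoungDiagram.mem_iff_lt_rowLen.mp hc).trans_le (h i))

lemma rowLen_pos_iff {i : ℕ} : 0 < ν.rowLen i ↔ i < ν.colLen 0 := by
  rw [← YoungDiagram.mem_iff_lt_rowLen, ← YoungDiagram.mem_iff_lt_colLen]

lemma rowLen_eq_zero_iff {i : ℕ} : ν.rowLen i = 0 ↔ ν.colLen 0 ≤ i := by
  rw [← not_lt, ← rowLen_pos_iff, Nat.pos_iff_ne_zero, not_not]

lemma le_rectDiagram_iff {N M : ℕ} :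
    ν ≤ rectDiagram N M ↔ ν.colLen 0 ≤ N ∧ ν.rowLen 0 ≤ M := by
  constructor
  · intro h
    constructor <;> by_contra! hlt
    · exact lt_irrefl N (mem_rectDiagram.mp (h (YoungDiagram.mem_iff_lt_colLen.mpr hlt))).1
    · exact lt_irrefl M (mem_rectDiagram.mp (h (YoungDiagram.mem_iff_lt_rowLen.mpr hlt))).2
  · rintro ⟨hN, hM⟩ ⟨i, j⟩ hc
    have hj := YoungDiagram.mem_iff_lt_rowLen.mp hc
    exact mem_rectDiagram.mpr ⟨(rowLen_pos_iff.mp (Nat.zero_lt_of_lt hj)).trans_le hN,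
      hj.trans_le ((ν.rowLen_anti 0 i (Nat.zero_le i)).trans hM)⟩

lemma sum_rowLen_eq_card {N : ℕ} (h : ν.colLen 0 ≤ N) :
    ∑ i ∈ range N, ν.rowLen i = ν.card := by
  simp only [YoungDiagram.rowLen_eq_card]
  refine (card_eq_sum_card_fiberwise fun c hc => ?_).symm
  have hpos := Nat.zero_lt_of_lt (YoungDiagram.mem_iff_lt_rowLen.mp hc)
  exact mem_coe.mpr (mem_range.mpr ((rowLen_pos_iff.mp hpos).trans_le h))

lemma le_card_of_not_le_rectDiagram {n : ℕ} (h : ¬ ν ≤ rectDiagram n n) : n ≤ ν.card := by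
  contrapose! h
  have hcol : ν.colLen 0 ≤ ν.card :=
    ν.colLen_eq_card.trans_le (card_le_card (filter_subset _ _))
  have hrow : ν.rowLen 0 ≤ ν.card :=
    ν.rowLen_eq_card.trans_le (card_le_card (filter_subset _ _))
  exact le_rectDiagram_iff.mpr ⟨hcol.trans h.le, hrow.trans h.le⟩

end Diagrams

section BetaNumbers

/-- The beta numbers `ν_i + N - 1 - i`, `0 ≤ i < N`, of a partition `ν` with at most `N` parts.
They are strictly decreasing in `i`, and turn the Jacobi–Trudi index `λ_i - μ_j - i + j` into a
difference of two naturals. -/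
def betaNumber (N : ℕ) (ν : YoungDiagram) (i : Fin N) : ℕ := ν.rowLen i + (N - 1 - i)

variable {N M : ℕ}

lemma betaNumber_strictAnti (N : ℕ) (ν : YoungDiagram) : StrictAnti (betaNumber N ν) := by
  intro i j (hij : (i : ℕ) < j)
  have := ν.rowLen_anti i j hij.le
  simp only [betaNumber]
  lia

lemma betaNumber_sub_betaNumber (α β : YoungDiagram) (i j : Fin N) :
    (betaNumber N α i : ℤ) - betaNumber N β j = (α.rowLen i : ℤ) - β.rowLen j - i + j := by
  have := i.isLt
  have := j.isLt
  simp only [betaNumber]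
  lia

lemma betaNumber_eq_zero_iff {α : YoungDiagram} (hα : α.colLen 0 ≤ N) {i : Fin (N + 1)} :
    betaNumber (N + 1) α i = 0 ↔ i = Fin.last N := by
  rw [betaNumber, Nat.add_eq_zero_iff, rowLen_eq_zero_iff, Fin.ext_iff, Fin.val_last]
  lia

lemma sum_betaNumber {ν : YoungDiagram} (h : ν.colLen 0 ≤ N) :
    ∑ i, betaNumber N ν i = ν.card + ∑ i : Fin N, (N - 1 - i) := by
  simp only [betaNumber, sum_add_distrib, ← sum_rowLen_eq_card h,
    Fin.sum_univ_eq_sum_range (fun i => ν.rowLen i)]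

lemma betaNumber_lt {ν : YoungDiagram} (h : ν ≤ rectDiagram N M) (i : Fin N) :
    betaNumber N ν i < N + M := by
  have := (ν.rowLen_anti 0 i (Nat.zero_le _)).trans (le_rectDiagram_iff.mp h).2
  simp only [betaNumber]
  lia

lemma betaNumber_injOn : Set.InjOn (betaNumber N) {ν | ν.colLen 0 ≤ N} := by
  have rowLen_le : ∀ {μ ν : YoungDiagram}, μ.colLen 0 ≤ N → betaNumber N μ = betaNumber N ν →
      μ ≤ ν := fun {μ ν} hμ h => le_iff_rowLen_le.mpr fun i => by
    by_cases hi : i < N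
    · have := congrFun h ⟨i, hi⟩
      simp only [betaNumber] at this
      lia
    · rw [rowLen_eq_zero_iff.mpr (hμ.trans (not_lt.mp hi))]
      exact Nat.zero_le _
  exact fun μ hμ ν hν h => le_antisymm (rowLen_le hμ h) (rowLen_le hν h.symm)

lemma antitone_add_of_strictAnti {s : Fin N → ℕ} (hs : StrictAnti s) :
    Antitone fun i => s i + i := by
  cases N with
  | zero => exact fun i => i.elim0
  | succ N =>
    refine Fin.antitone_iff_succ_le.mpr fun i => ?_
    have : s i.succ < s i.castSucc := hs i.castSucc_lt_succ
    simp only [Fin.val_succ, Fin.val_castSucc]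
    lia

lemma exists_betaNumber_eq {s : Fin N → ℕ} (hs : StrictAnti s) (hM : ∀ i, s i < N + M) :
    ∃ ν ≤ rectDiagram N M, betaNumber N ν = s := by
  have hanti := antitone_add_of_strictAnti hs
  have hlower : ∀ i, N - 1 ≤ s i + i := fun i =>
    have hlast : i ≤ ⟨N - 1, Nat.sub_one_lt_of_lt i.pos⟩ := Nat.le_sub_one_of_lt i.isLt
    (Nat.le_add_left _ _).trans (hanti hlast)
  have hupper : ∀ i, s i + i - (N - 1) ≤ M := fun i => by
    have hfirst : s i + i ≤ s ⟨0, i.pos⟩ + 0 := hanti (Fin.le_def.mpr (Nat.zero_le _))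
    have := hM ⟨0, i.pos⟩
    lia
  have hsorted : (List.ofFn fun i => s i + i - (N - 1)).SortedGE :=
    Antitone.sortedGE_ofFn fun i j hij => Nat.sub_le_sub_right (hanti hij) _
  refine ⟨YoungDiagram.ofRowLens _ hsorted, fun c hc => ?_, funext fun i => ?_⟩
  · obtain ⟨hrow, hcol⟩ := YoungDiagram.mem_ofRowLens.mp hc
    rw [List.getElem_ofFn] at hcol
    exact mem_rectDiagram.mpr ⟨by simpa using hrow, hcol.trans_le (hupper _)⟩
  · have hrow := YoungDiagram.rowLen_ofRowLens (hw := hsorted) ⟨i, by simp⟩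
    simp only [Fin.getElem_fin, List.getElem_ofFn, Fin.eta] at hrow
    have := hlower i
    rw [betaNumber, hrow]
    lia

/-- The beta numbers of a diagram inside the `N × M` rectangle, as a choice of `N` elements of
`{0, …, N + M - 1}`. -/
def betaEmbedding {ν : YoungDiagram} (h : ν ≤ rectDiagram N M) : Fin N ↪o (Fin (N + M))ᵒᵈ :=
  OrderEmbedding.ofStrictMono
    (fun i => OrderDual.toDual (⟨betaNumber N ν i, betaNumber_lt h i⟩ : Fin (N + M)))
    (fun _ _ hij => betaNumber_strictAnti N ν hij)

/-- The Cauchy–Binet formula, with the choices of columns indexed by beta numbers. -/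
lemma sum_det_betaNumber_mul_det_betaNumber {R : Type*} [CommRing R] (N M : ℕ)
    (A B : Fin N → ℕ → R) :
    ∑ ν ∈ Iic (rectDiagram N M), (Matrix.of fun i j => A i (betaNumber N ν j)).det *
        (Matrix.of fun i j => B i (betaNumber N ν j)).det =
      (Matrix.of fun i j : Fin N => ∑ k ∈ range (N + M), A i k * B j k).det := by
  let toMatrix (A : Fin N → ℕ → R) : Matrix (Fin N) (Fin (N + M))ᵒᵈ R :=
    Matrix.of fun i k => A i (OrderDual.ofDual k : Fin (N + M))
  have hmul : (Matrix.of fun i j : Fin N => ∑ k ∈ range (N + M), A i k * B j k) =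
      toMatrix A * (toMatrix B).transpose := by
    ext i j
    rw [Matrix.of_apply, ← Fin.sum_univ_eq_sum_range (fun k => A i k * B j k)]
    exact Fintype.sum_equiv OrderDual.toDual _ _ fun _ => rfl
  rw [hmul, det_mul_transpose_eq_sum_det_submatrix]
  refine sum_bij (fun ν hν => betaEmbedding (mem_Iic.mp hν)) (fun _ _ => mem_univ _) ?_ ?_
    (fun _ _ => rfl)
  · intro μ hμ ν hν h
    refine betaNumber_injOn (le_rectDiagram_iff.mp (mem_Iic.mp hμ)).1
      (le_rectDiagram_iff.mp (mem_Iic.mp hν)).1 (funext fun i => ?_)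
    exact congrArg Fin.val (congrArg OrderDual.ofDual (DFunLike.congr_fun h i))
  · intro e _
    obtain ⟨ν, hν, h⟩ := exists_betaNumber_eq
      (s := fun i => ((OrderDual.ofDual (e i) : Fin (N + M)) : ℕ))
      (fun i j hij => e.strictMono hij) (fun i => (OrderDual.ofDual (e i)).isLt)
    exact ⟨ν, mem_Iic.mpr hν, DFunLike.ext (betaEmbedding hν) e fun i =>
      congrArg OrderDual.toDual (Fin.ext (congrFun h i))⟩

end BetaNumbers

section JacobiTrudi

variable {R : Type*} [CommRing R]

/-- The `r`-th coefficient of a power series for `r : ℤ`, zero when `r < 0`. -/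
noncomputable def intCoeff (F : PowerSeries R) (r : ℤ) : R :=
  if r < 0 then 0 else PowerSeries.coeff r.toNat F

lemma intCoeff_of_neg {F : PowerSeries R} {r : ℤ} (h : r < 0) : intCoeff F r = 0 := if_pos h

@[simp]
lemma intCoeff_natCast (F : PowerSeries R) (n : ℕ) :
    intCoeff F n = PowerSeries.coeff n F := by
  simp [intCoeff]

lemma intCoeff_one (r : ℤ) : intCoeff (1 : PowerSeries R) r = if r = 0 then 1 else 0 := by
  rcases lt_or_ge r 0 with h | h
  · rw [intCoeff_of_neg h, if_neg h.ne]
  · lift r to ℕ using h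
    simp [PowerSeries.coeff_one]

lemma intCoeff_natCast_sub_natCast (F : PowerSeries R) (k b : ℕ) :
    intCoeff F (k - b) = PowerSeries.coeff k (PowerSeries.X ^ b * F) := by
  rw [PowerSeries.coeff_X_pow_mul']
  split_ifs with h
  · rw [← Nat.cast_sub h, intCoeff_natCast]
  · exact intCoeff_of_neg (by lia)

lemma sum_intCoeff_mul_intCoeff (F G : PowerSeries R) {a K : ℕ} (b : ℕ) (h : a < K) :
    ∑ k ∈ range K, intCoeff F (a - k) * intCoeff G (k - b) = intCoeff (F * G) (a - b) := by
  calc ∑ k ∈ range K, intCoeff F (a - k) * intCoeff G (k - b)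
      = ∑ k ∈ range (a + 1), intCoeff F (a - k) * intCoeff G (k - b) := by
        refine (sum_subset (range_subset_range.mpr h) fun k _ hk => ?_).symm
        rw [mem_range] at hk
        rw [intCoeff_of_neg (by lia), zero_mul]
    _ = ∑ k ∈ range (a + 1),
          PowerSeries.coeff k (PowerSeries.X ^ b * G) * PowerSeries.coeff (a - k) F := by
        refine sum_congr rfl fun k hk => ?_
        rw [intCoeff_natCast_sub_natCast G, ← Nat.cast_sub (mem_range_succ_iff.mp hk),
          intCoeff_natCast, mul_comm]
    _ = intCoeff (F * G) (a - b) := by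
        rw [← Nat.sum_antidiagonal_eq_sum_range_succ fun k l =>
            PowerSeries.coeff k (PowerSeries.X ^ b * G) * PowerSeries.coeff l F,
          ← PowerSeries.coeff_mul, intCoeff_natCast_sub_natCast]
        ring_nf

/-- The Jacobi–Trudi matrix `(h_{α_i - β_j - i + j})` of size `N`, where `h_r` is the `r`-th
coefficient of `F`; see `betaNumber_sub_betaNumber` for the index. -/
noncomputable def jacobiTrudi (F : PowerSeries R) (N : ℕ) (α β : YoungDiagram) :
    Matrix (Fin N) (Fin N) R :=
  Matrix.of fun i j => intCoeff F ((betaNumber N α i : ℤ) - betaNumber N β j)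

/-- The skew Schur function `s_{α/β}` under the specialization sending `h_r` to the `r`-th
coefficient of `F`. The size of the determinant is the larger of the numbers of parts. -/
noncomputable def skewSchur (F : PowerSeries R) (α β : YoungDiagram) : R :=
  (jacobiTrudi F (max (α.colLen 0) (β.colLen 0)) α β).det

variable {F G : PowerSeries R} {N M : ℕ} {α β : YoungDiagram}

lemma det_jacobiTrudi_succ (hF : PowerSeries.constantCoeff F = 1) (hα : α.colLen 0 ≤ N)
    (hβ : β.colLen 0 ≤ N) : (jacobiTrudi F (N + 1) α β).det = (jacobiTrudi F N α β).det := by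
  have hrow : ∀ j ≠ Fin.last N, jacobiTrudi F (N + 1) α β (Fin.last N) j = 0 := fun j hj => by
    have := Nat.pos_of_ne_zero (mt (betaNumber_eq_zero_iff hβ).mp hj)
    rw [jacobiTrudi, Matrix.of_apply, (betaNumber_eq_zero_iff hα).mpr rfl]
    exact intCoeff_of_neg (by lia)
  have hcorner : jacobiTrudi F (N + 1) α β (Fin.last N) (Fin.last N) = 1 := by
    rw [jacobiTrudi, Matrix.of_apply, (betaNumber_eq_zero_iff hα).mpr rfl,
      (betaNumber_eq_zero_iff hβ).mpr rfl, sub_self, ← Nat.cast_zero, intCoeff_natCast,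
      PowerSeries.coeff_zero_eq_constantCoeff_apply, hF]
  rw [Matrix.det_succ_row _ (Fin.last N), sum_eq_single (Fin.last N)
    (fun j _ hj => by rw [hrow j hj, mul_zero, zero_mul]) (fun h => absurd (mem_univ _) h),
    hcorner, Even.neg_one_pow ⟨_, rfl⟩, one_mul, one_mul]
  congr 1
  ext i j
  simp [jacobiTrudi, betaNumber_sub_betaNumber]

lemma det_jacobiTrudi_eq_skewSchur (hF : PowerSeries.constantCoeff F = 1) (hα : α.colLen 0 ≤ N)
    (hβ : β.colLen 0 ≤ N) : (jacobiTrudi F N α β).det = skewSchur F α β := by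
  induction N, max_le hα hβ using Nat.le_induction with
  | base => rfl
  | succ N hN ih =>
    have hαN := (le_max_left _ _).trans hN
    have hβN := (le_max_right _ _).trans hN
    rw [det_jacobiTrudi_succ hF hαN hβN, ih hαN hβN]

lemma exists_le_and_le_perm_apply {N : ℕ} (p : Fin N) (σ : Equiv.Perm (Fin N)) :
    ∃ j ≤ p, p ≤ σ j := by
  by_contra! h
  have hcard : #(Iic p) ≤ #(Iio p) :=
    card_le_card_of_injOn σ (fun j hj => by simpa using h j (by simpa using hj))
      σ.injective.injOn
  simp at hcard

lemma det_jacobiTrudi_eq_zero (hβ : β.colLen 0 ≤ N) (h : ¬ β ≤ α) :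
    (jacobiTrudi F N α β).det = 0 := by
  rw [le_iff_rowLen_le] at h
  push Not at h
  obtain ⟨p, hp⟩ := h
  have hpN : p < N := (rowLen_pos_iff.mp (Nat.zero_lt_of_lt hp)).trans_le hβ
  rw [Matrix.det_apply']
  refine sum_eq_zero fun σ _ => ?_
  obtain ⟨j, hjp, hpσ⟩ := exists_le_and_le_perm_apply ⟨p, hpN⟩ σ
  have hα := α.rowLen_anti p (σ j) hpσ
  have hβ := β.rowLen_anti j p hjp
  rw [prod_eq_zero (mem_univ j), mul_zero]
  rw [jacobiTrudi, Matrix.of_apply, betaNumber_sub_betaNumber]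
  rw [Fin.le_def] at hjp hpσ
  exact intCoeff_of_neg (by lia)

lemma skewSchur_eq_zero (h : ¬ β ≤ α) : skewSchur F α β = 0 :=
  det_jacobiTrudi_eq_zero (le_max_right _ _) h

lemma sum_Iic_skewSchur_mul_of_le (F : PowerSeries R) (f : YoungDiagram → R) (h : α ≤ β) :
    ∑ ν ∈ Iic α, skewSchur F α ν * f ν = ∑ ν ∈ Iic β, skewSchur F α ν * f ν := by
  refine sum_subset (Iic_subset_Iic.mpr h) fun ν _ hν => ?_
  rw [skewSchur_eq_zero (mt mem_Iic.mpr hν), zero_mul]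

lemma transpose_jacobiTrudi_one :
    (jacobiTrudi (1 : PowerSeries R) N α β).transpose = jacobiTrudi 1 N β α := by
  ext i j
  simp only [jacobiTrudi, Matrix.transpose_apply, Matrix.of_apply, intCoeff_one, sub_eq_zero]
  exact if_congr eq_comm rfl rfl

lemma skewSchur_one_self (α : YoungDiagram) : skewSchur (1 : PowerSeries R) α α = 1 := by
  have hone : jacobiTrudi (1 : PowerSeries R) (max (α.colLen 0) (α.colLen 0)) α α = 1 := by
    ext i j
    simp only [jacobiTrudi, Matrix.of_apply, intCoeff_one, Matrix.one_apply, sub_eq_zero,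
      Nat.cast_inj, (betaNumber_strictAnti _ α).injective.eq_iff]
  rw [skewSchur, hone, Matrix.det_one]

lemma skewSchur_one_of_ne (h : α ≠ β) : skewSchur (1 : PowerSeries R) α β = 0 := by
  by_cases hβα : β ≤ α
  · rw [skewSchur, ← Matrix.det_transpose, transpose_jacobiTrudi_one]
    exact det_jacobiTrudi_eq_zero (le_max_left _ _) fun hαβ => h (le_antisymm hαβ hβα)
  · exact skewSchur_eq_zero hβα

lemma skewSchur_mul (hF : PowerSeries.constantCoeff F = 1)
    (hG : PowerSeries.constantCoeff G = 1) (α β : YoungDiagram) :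
    skewSchur (F * G) α β = ∑ ν ∈ Iic α, skewSchur F α ν * skewSchur G ν β := by
  set N := max (α.colLen 0) (β.colLen 0)
  have hα : α ≤ rectDiagram N (α.rowLen 0) := le_rectDiagram_iff.mpr ⟨le_max_left _ _, le_rfl⟩
  calc skewSchur (F * G) α β
      = (Matrix.of fun i j => ∑ k ∈ range (N + α.rowLen 0), intCoeff F (betaNumber N α i - k) *
          intCoeff G (k - betaNumber N β j)).det := by
        simp only [sum_intCoeff_mul_intCoeff F G _ (betaNumber_lt hα _)]
        rfl
    _ = ∑ ν ∈ Iic (rectDiagram N (α.rowLen 0)),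
          (jacobiTrudi F N α ν).det * (jacobiTrudi G N ν β).det := by
        rw [← sum_det_betaNumber_mul_det_betaNumber N (α.rowLen 0)
          (fun i k => intCoeff F (betaNumber N α i - k))
          (fun j k => intCoeff G (k - betaNumber N β j))]
        refine sum_congr rfl fun ν _ => ?_
        rw [← Matrix.det_transpose (jacobiTrudi G N ν β)]
        rfl
    _ = ∑ ν ∈ Iic (rectDiagram N (α.rowLen 0)), skewSchur F α ν * skewSchur G ν β := by
        refine sum_congr rfl fun ν hν => ?_
        have hν := (le_rectDiagram_iff.mp (mem_Iic.mp hν)).1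
        rw [det_jacobiTrudi_eq_skewSchur hF (le_max_left _ _) hν,
          det_jacobiTrudi_eq_skewSchur hG hν (le_max_right _ _)]
    _ = ∑ ν ∈ Iic α, skewSchur F α ν * skewSchur G ν β :=
        (sum_Iic_skewSchur_mul_of_le F (skewSchur G · β) hα).symm

/-- The skewing operator of the specialization `F` on functions of a partition,
`f ↦ (α ↦ ∑ ν ≤ α, s_{α/ν} f(ν))`. -/
noncomputable def skewingOperator (F : PowerSeries R) : Module.End R (YoungDiagram → R) where
  toFun f α := ∑ ν ∈ Iic α, skewSchur F α ν * f ν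
  map_add' f g := by
    ext α
    simp only [Pi.add_apply, mul_add, sum_add_distrib]
  map_smul' c f := by
    ext α
    simp only [Pi.smul_apply, smul_eq_mul, RingHom.id_apply, mul_sum, mul_left_comm c]

lemma skewingOperator_apply (F : PowerSeries R) (f : YoungDiagram → R) (α : YoungDiagram) :
    skewingOperator F f α = ∑ ν ∈ Iic α, skewSchur F α ν * f ν := rfl

@[simp]
lemma skewingOperator_one : skewingOperator (1 : PowerSeries R) = 1 := by
  ext f α
  rw [skewingOperator_apply, sum_eq_single_of_mem α (mem_Iic.mpr le_rfl)
    fun ν _ hν => by rw [skewSchur_one_of_ne hν.symm, zero_mul], skewSchur_one_self, one_mul,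
    Module.End.one_apply]

lemma skewingOperator_mul (hF : PowerSeries.constantCoeff F = 1)
    (hG : PowerSeries.constantCoeff G = 1) :
    skewingOperator (F * G) = skewingOperator F * skewingOperator G := by
  ext f α
  calc skewingOperator (F * G) f α
      = ∑ ν ∈ Iic α, ∑ τ ∈ Iic α, skewSchur F α τ * (skewSchur G τ ν * f ν) := by
        simp only [skewingOperator_apply, skewSchur_mul hF hG, sum_mul, mul_assoc]
    _ = ∑ τ ∈ Iic α, skewSchur F α τ * ∑ ν ∈ Iic α, skewSchur G τ ν * f ν := by
        rw [sum_comm]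
        simp only [mul_sum]
    _ = skewingOperator F (skewingOperator G f) α :=
        sum_congr rfl fun τ hτ => by
          rw [← sum_Iic_skewSchur_mul_of_le G f (mem_Iic.mp hτ), skewingOperator_apply]

end JacobiTrudi

section Series

variable {R : Type*} [CommRing R]

/-- The generating series `1 + y t` of the specialization to one dual variable `y`. -/
noncomputable def linSeries (y : R) : PowerSeries R := 1 + PowerSeries.C y * PowerSeries.X

/-- The generating series `1 / (1 - x t)` of the specialization to one variable `x`. -/
noncomputable def geomSeries (x : R) : PowerSeries R := PowerSeries.mk (x ^ ·)

/-- The generating series `∏ (1 + y_i t) / (1 - x_i t)` of the supersymmetric complete homogeneous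
functions. -/
noncomputable def superSeries {ι : Type*} [Fintype ι] (x y : ι → R) : PowerSeries R :=
  ∏ i, (geomSeries (x i) * linSeries (y i))

@[simp]
lemma constantCoeff_linSeries (y : R) : PowerSeries.constantCoeff (linSeries y) = 1 := by
  simp [linSeries]

@[simp]
lemma constantCoeff_geomSeries (x : R) : PowerSeries.constantCoeff (geomSeries x) = 1 := by
  rw [← PowerSeries.coeff_zero_eq_constantCoeff_apply, geomSeries, PowerSeries.coeff_mk, pow_zero]

lemma linSeries_neg_mul_geomSeries (x : R) : linSeries (-x) * geomSeries x = 1 := by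
  rw [linSeries, map_neg, neg_mul, ← sub_eq_add_neg, mul_comm]
  have hgeom : geomSeries x = PowerSeries.rescale x (PowerSeries.mk 1) := by
    ext
    simp [geomSeries]
  have hlin : 1 - PowerSeries.C x * PowerSeries.X = PowerSeries.rescale x (1 - PowerSeries.X) := by
    simp [PowerSeries.rescale_X]
  rw [hgeom, hlin, ← map_mul, PowerSeries.mk_one_mul_one_sub_eq_one, map_one]

lemma coeff_prod_linSeries {ι : Type*} [Fintype ι] (y : ι → R) (r : ℕ) :
    PowerSeries.coeff r (∏ i, linSeries (y i)) =
      MvPolynomial.aeval y (MvPolynomial.esymm ι ℤ r) := by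
  have hterm : ∀ s : Finset ι, PowerSeries.coeff r (∏ i ∈ s, PowerSeries.C (y i) * PowerSeries.X) =
      if #s = r then ∏ i ∈ s, y i else 0 := fun s => by
    rw [prod_mul_distrib, prod_const, ← map_prod, PowerSeries.coeff_C_mul,
      PowerSeries.coeff_X_pow, mul_ite, mul_one, mul_zero]
    exact if_congr eq_comm rfl rfl
  simp only [linSeries, prod_one_add, map_sum, hterm, MvPolynomial.esymm, map_prod,
    MvPolynomial.aeval_X]
  rw [← sum_filter, powersetCard_eq_filter]

lemma coeff_prod_geomSeries {ι : Type*} [Fintype ι] [DecidableEq ι] (x : ι → R) (r : ℕ) :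
    PowerSeries.coeff r (∏ i, geomSeries (x i)) =
      MvPolynomial.aeval x (MvPolynomial.hsymm ι ℤ r) := by
  have hmonomial : ∀ s : Sym ι r,
      MvPolynomial.aeval x ((s.1.map (MvPolynomial.X (R := ℤ))).prod) =
        ∏ i, x i ^ s.1.count i := fun s => by
    rw [← Multiset.prod_hom, Multiset.map_map]
    simp only [Function.comp_def, MvPolynomial.aeval_X]
    exact prod_multiset_map_count _ _ |>.trans <| prod_subset (subset_univ _) fun i _ hi => by
      rw [Multiset.count_eq_zero_of_notMem (mt Multiset.mem_toFinset.mpr hi), pow_zero]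
  have hcard : ∀ s : Multiset ι, ∑ i, s.count i = s.card := fun s =>
    Multiset.sum_count_eq_card fun _ _ => mem_univ _
  rw [PowerSeries.coeff_prod, MvPolynomial.hsymm, map_sum]
  simp only [hmonomial, geomSeries, PowerSeries.coeff_mk]
  symm
  refine sum_bij (fun s _ => Multiset.toFinsupp s.1)
    (fun s _ => mem_finsuppAntidiag.mpr ⟨(hcard s.1).trans s.2, subset_univ _⟩)
    (fun s _ t _ h => Subtype.ext (Multiset.toFinsupp.injective h)) (fun l hl => ?_)
    (fun s _ => rfl)
  refine ⟨⟨Finsupp.toMultiset l, ?_⟩, mem_univ _, by simp⟩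
  rw [← hcard, ← (mem_finsuppAntidiag.mp hl).1]
  simp only [Finsupp.count_toMultiset]

lemma superH_eq_intCoeff {n : ℕ} (x y : Fin n → R) (r : ℤ) :
    superH x y r = intCoeff (superSeries x y) r := by
  simp only [superH, intCoeff, superSeries, prod_mul_distrib, PowerSeries.coeff_mul,
    coeff_prod_geomSeries, coeff_prod_linSeries]

lemma superSchur_eq_skewSchur {n : ℕ} (α β : YoungDiagram) (x y : Fin n → R) :
    superSchur α β x y = skewSchur (superSeries x y) α β := by
  simp only [superSchur, skewSchur, jacobiTrudi, superH_eq_intCoeff, betaNumber_sub_betaNumber]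

end Series

section OneVariable

variable {R : Type*} [CommRing R]

lemma intCoeff_linSeries (y : R) (r : ℤ) :
    intCoeff (linSeries y) r = (if r = 0 then 1 else 0) + if r = 1 then y else 0 := by
  rcases lt_or_ge r 0 with h | h
  · rw [intCoeff_of_neg h, if_neg (by lia), if_neg (by lia), add_zero]
  · lift r to ℕ using h
    simp [linSeries, PowerSeries.coeff_one, PowerSeries.coeff_X]

lemma intCoeff_geomSeries_natCast (z : R) (n : ℕ) : intCoeff (geomSeries z) n = z ^ n := by
  simp [geomSeries]

lemma sum_intCoeff_linSeries_natCast_sub_mul (y : R) (g : ℕ → R) {a K : ℕ} (h : a < K) :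
    ∑ k ∈ range K, intCoeff (linSeries y) (a - k) * g k =
      g a + if a = 0 then 0 else y * g (a - 1) := by
  simp only [intCoeff_linSeries, add_mul, sum_add_distrib, ite_mul, one_mul, zero_mul]
  congr 1
  · rw [sum_eq_single_of_mem a (mem_range.mpr h) fun k _ hk => if_neg (by lia),
      if_pos (sub_self _)]
  · split_ifs with ha
    · exact sum_eq_zero fun k _ => if_neg (by lia)
    · rw [sum_eq_single_of_mem (a - 1) (mem_range.mpr (by lia)) fun k _ hk => if_neg (by lia),
        if_pos (by lia)]

lemma sum_intCoeff_linSeries_sub_natCast_mul (y : R) (g : ℕ → R) {b K : ℕ} (h : b + 1 < K) :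
    ∑ k ∈ range K, intCoeff (linSeries y) (k - b) * g k = g b + y * g (b + 1) := by
  simp only [intCoeff_linSeries, add_mul, sum_add_distrib, ite_mul, one_mul, zero_mul]
  congr 1
  · rw [sum_eq_single_of_mem b (mem_range.mpr (by lia)) fun k _ hk => if_neg (by lia),
      if_pos (sub_self _)]
  · rw [sum_eq_single_of_mem (b + 1) (mem_range.mpr h) fun k _ hk => if_neg (by lia),
      if_pos (by lia)]

variable {H : PowerSeries R} {α β : YoungDiagram} {N M : ℕ}

lemma sum_skewSchur_linSeries_mul_skewSchur_of_le (hH : PowerSeries.constantCoeff H = 1) (y : R)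
    (hα : α.colLen 0 ≤ N) (hβ : β.colLen 0 ≤ N) :
    ∑ ν ∈ Iic α, skewSchur (linSeries y) α ν * skewSchur H β ν =
      (Matrix.of fun i j => intCoeff H ((betaNumber N β j : ℤ) - betaNumber N α i) +
        if betaNumber N α i = 0 then 0
        else y * intCoeff H ((betaNumber N β j : ℤ) + 1 - betaNumber N α i)).det := by
  set M := α.rowLen 0
  have hαM : α ≤ rectDiagram N M := le_rectDiagram_iff.mpr ⟨hα, le_rfl⟩
  calc ∑ ν ∈ Iic α, skewSchur (linSeries y) α ν * skewSchur H β ν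
      = ∑ ν ∈ Iic (rectDiagram N M), skewSchur (linSeries y) α ν * skewSchur H β ν :=
        sum_Iic_skewSchur_mul_of_le _ _ hαM
    _ = ∑ ν ∈ Iic (rectDiagram N M),
          (jacobiTrudi (linSeries y) N α ν).det * (jacobiTrudi H N β ν).det := by
        refine sum_congr rfl fun ν hν => ?_
        have hν := (le_rectDiagram_iff.mp (mem_Iic.mp hν)).1
        rw [det_jacobiTrudi_eq_skewSchur (constantCoeff_linSeries y) hα hν,
          det_jacobiTrudi_eq_skewSchur hH hβ hν]
    _ = (Matrix.of fun i j => ∑ k ∈ range (N + M),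
          intCoeff (linSeries y) (betaNumber N α i - k) *
            intCoeff H (betaNumber N β j - k)).det :=
        sum_det_betaNumber_mul_det_betaNumber N M
          (fun i k => intCoeff (linSeries y) (betaNumber N α i - k))
          (fun j k => intCoeff H (betaNumber N β j - k))
    _ = _ := by
        congr 2
        ext i j
        rw [sum_intCoeff_linSeries_natCast_sub_mul y (fun k => intCoeff H (betaNumber N β j - k))
          (betaNumber_lt hαM i)]
        congr 1
        refine ite_congr rfl (fun _ => rfl) fun hi => ?_
        rw [Nat.cast_pred (Nat.pos_of_ne_zero hi), sub_sub_eq_add_sub]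

lemma sum_rectDiagram_skewSchur_linSeries_mul_skewSchur (hH : PowerSeries.constantCoeff H = 1)
    (y : R) (hα : α.colLen 0 ≤ N) (hβ : β.colLen 0 ≤ N) (hβM : β.rowLen 0 < M) :
    ∑ ν ∈ Iic (rectDiagram N M), skewSchur (linSeries y) ν β * skewSchur H ν α =
      (Matrix.of fun i j => intCoeff H ((betaNumber N β j : ℤ) - betaNumber N α i) +
        y * intCoeff H ((betaNumber N β j : ℤ) + 1 - betaNumber N α i)).det := by
  have hb : ∀ j, betaNumber N β j + 1 < N + M := fun j => by
    have := betaNumber_lt (le_rectDiagram_iff.mpr ⟨hβ, le_rfl⟩) j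
    lia
  calc ∑ ν ∈ Iic (rectDiagram N M), skewSchur (linSeries y) ν β * skewSchur H ν α
      = ∑ ν ∈ Iic (rectDiagram N M), (jacobiTrudi H N ν α).transpose.det *
          (jacobiTrudi (linSeries y) N ν β).transpose.det := by
        refine sum_congr rfl fun ν hν => ?_
        have hν := (le_rectDiagram_iff.mp (mem_Iic.mp hν)).1
        rw [Matrix.det_transpose, Matrix.det_transpose, det_jacobiTrudi_eq_skewSchur hH hν hα,
          det_jacobiTrudi_eq_skewSchur (constantCoeff_linSeries y) hν hβ, mul_comm]
    _ = (Matrix.of fun i j => ∑ k ∈ range (N + M), intCoeff H (k - betaNumber N α i) *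
          intCoeff (linSeries y) (k - betaNumber N β j)).det :=
        sum_det_betaNumber_mul_det_betaNumber N M
          (fun i k => intCoeff H (k - betaNumber N α i))
          (fun j k => intCoeff (linSeries y) (k - betaNumber N β j))
    _ = _ := by
        congr 2
        ext i j
        simp only [mul_comm (intCoeff H _)]
        rw [sum_intCoeff_linSeries_sub_natCast_mul y (fun k => intCoeff H (k - betaNumber N α i))
          (hb j), Nat.cast_succ]

lemma sum_rectDiagram_skewSchur_linSeries_mul_skewSchur_geomSeries (y z : R)
    (hα : α.colLen 0 ≤ N) (hβ : β.colLen 0 ≤ N + 1) (hβM : β.rowLen 0 < M) :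
    ∑ ν ∈ Iic (rectDiagram (N + 1) M),
        skewSchur (linSeries y) ν β * skewSchur (geomSeries z) ν α =
      (1 + y * z) * ∑ ν ∈ Iic α, skewSchur (linSeries y) α ν * skewSchur (geomSeries z) β ν := by
  have hαN : α.colLen 0 ≤ N + 1 := Nat.le_succ_of_le hα
  rw [sum_rectDiagram_skewSchur_linSeries_mul_skewSchur (constantCoeff_geomSeries z) y hαN hβ hβM,
    sum_skewSchur_linSeries_mul_skewSchur_of_le (constantCoeff_geomSeries z) y hαN hβ]
  -- The two matrices differ only in the last row, where the beta number of `α` vanishes.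
  set L := Matrix.of fun i j : Fin (N + 1) => intCoeff (geomSeries z)
      ((betaNumber (N + 1) β j : ℤ) - betaNumber (N + 1) α i) +
    if betaNumber (N + 1) α i = 0 then 0
    else y * intCoeff (geomSeries z) ((betaNumber (N + 1) β j : ℤ) + 1 - betaNumber (N + 1) α i)
  rw [← Matrix.updateRow_eq_self L (Fin.last N), ← Matrix.det_updateRow_smul]
  congr 1
  ext i j
  rcases eq_or_ne i (Fin.last N) with rfl | hi
  · have hzero := (betaNumber_eq_zero_iff hα).mpr rfl
    have hsucc : (betaNumber (N + 1) β j : ℤ) + 1 = (betaNumber (N + 1) β j + 1 : ℕ) := by simp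
    simp only [L, Matrix.updateRow_self, Matrix.of_apply, Pi.smul_apply, smul_eq_mul, hzero,
      Nat.cast_zero, sub_zero, hsucc, intCoeff_geomSeries_natCast, if_true]
    ring
  · simp only [L, Matrix.updateRow_ne hi, Matrix.of_apply,
      if_neg (mt (betaNumber_eq_zero_iff hα).mp hi)]

end OneVariable

section OrderIdeal

variable {σ R : Type*} [CommRing R]

/-- The ideal of the power series of order at least `d`. The ideals `orderIdeal σ R d` are used as
a basis of neighbourhoods of zero, to compare formal sums through congruences. -/
noncomputable def orderIdeal (σ R : Type*) [CommRing R] (d : ℕ) : Ideal (MvPowerSeries σ R) where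
  carrier := {f | d ≤ f.order}
  add_mem' hf hg := (le_min hf hg).trans MvPowerSeries.min_order_le_add
  zero_mem' := by simp
  smul_mem' _ _ hf := (le_trans hf le_add_self).trans MvPowerSeries.le_order_mul

lemma mem_orderIdeal {d : ℕ} {f : MvPowerSeries σ R} : f ∈ orderIdeal σ R d ↔ d ≤ f.order :=
  Iff.rfl

lemma mem_orderIdeal_iff_coeff_eq_zero {d : ℕ} {f : MvPowerSeries σ R} :
    f ∈ orderIdeal σ R d ↔ ∀ m, m.degree < d → MvPowerSeries.coeff m f = 0 :=
  ⟨fun h _ hm => MvPowerSeries.coeff_of_lt_order ((Nat.cast_lt.mpr hm).trans_le h),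
    MvPowerSeries.nat_le_order⟩

lemma orderIdeal_antitone : Antitone (orderIdeal σ R) :=
  fun _ _ hde _ hf => (Nat.cast_le.mpr hde).trans (mem_orderIdeal.mp hf)

lemma mul_mem_orderIdeal_add {d e : ℕ} {f g : MvPowerSeries σ R} (hf : f ∈ orderIdeal σ R d)
    (hg : g ∈ orderIdeal σ R e) : f * g ∈ orderIdeal σ R (d + e) := by
  rw [mem_orderIdeal, Nat.cast_add]
  exact (add_le_add hf hg).trans MvPowerSeries.le_order_mul

lemma prod_mem_orderIdeal_sum {ι : Type*} (s : Finset ι) {f : ι → MvPowerSeries σ R} {d : ι → ℕ}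
    (h : ∀ i ∈ s, f i ∈ orderIdeal σ R (d i)) :
    ∏ i ∈ s, f i ∈ orderIdeal σ R (∑ i ∈ s, d i) := by
  rw [mem_orderIdeal, Nat.cast_sum]
  exact (sum_le_sum h).trans (MvPowerSeries.le_order_prod _ _)

lemma eq_of_forall_smodEq_orderIdeal {f g : MvPowerSeries σ R}
    (h : ∀ d, f ≡ g [SMOD orderIdeal σ R d]) : f = g := by
  ext m
  have hcoeff := mem_orderIdeal_iff_coeff_eq_zero.mp (SModEq.sub_mem.mp (h (m.degree + 1))) m
    (Nat.lt_succ_self _)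
  rwa [map_sub, sub_eq_zero] at hcoeff

variable {ι : Type*} {f : ι → MvPowerSeries σ R}

lemma formalSum_smodEq_sum {s : Finset ι} {d : ℕ} (h : ∀ k ∉ s, f k ∈ orderIdeal σ R d) :
    formalSum f ≡ ∑ k ∈ s, f k [SMOD orderIdeal σ R d] := by
  rw [SModEq.sub_mem, mem_orderIdeal_iff_coeff_eq_zero]
  intro m hm
  rw [map_sub, map_sum, sub_eq_zero]
  refine finsum_eq_sum_of_support_subset _ fun k hk => ?_
  by_contra hks
  exact hk (mem_orderIdeal_iff_coeff_eq_zero.mp (h k hks) m hm)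

lemma formalSum_eq_sum {s : Finset ι} (h : ∀ k ∉ s, f k = 0) : formalSum f = ∑ k ∈ s, f k :=
  eq_of_forall_smodEq_orderIdeal fun _ => formalSum_smodEq_sum fun k hk =>
    (h k hk).symm ▸ zero_mem _

lemma formallySummable_of_forall_exists_finset
    (h : ∀ d, ∃ s : Finset ι, ∀ k ∉ s, f k ∈ orderIdeal σ R d) : FormallySummable f := by
  intro m
  obtain ⟨s, hs⟩ := h (m.degree + 1)
  refine s.finite_toSet.subset fun k hk => ?_
  by_contra hks
  exact hk (mem_orderIdeal_iff_coeff_eq_zero.mp (hs k hks) m (Nat.lt_succ_self _))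

/-- A series `∑ h_r t^r` over a ring of formal power series is *graded* if `h_r` has order at
least `r`. This makes the Schur functions `s_{ν/α}` small for large `ν`, hence the sum over the
diagrams `ν` containing `α` convergent. -/
def IsGraded (F : PowerSeries (MvPowerSeries σ R)) : Prop :=
  ∀ r, PowerSeries.coeff r F ∈ orderIdeal σ R r

namespace IsGraded

variable {F G : PowerSeries (MvPowerSeries σ R)}

lemma intCoeff_mem (hF : IsGraded F) (r : ℤ) : intCoeff F r ∈ orderIdeal σ R r.toNat := by
  rw [intCoeff]
  split_ifs
  · exact zero_mem _
  · exact hF _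

lemma one : IsGraded (1 : PowerSeries (MvPowerSeries σ R)) := fun r => by
  rw [PowerSeries.coeff_one]
  split_ifs with hr
  · simp [hr, mem_orderIdeal]
  · exact zero_mem _

lemma mul (hF : IsGraded F) (hG : IsGraded G) : IsGraded (F * G) := fun r => by
  rw [PowerSeries.coeff_mul]
  refine sum_mem fun p hp => ?_
  rw [← mem_antidiagonal.mp hp]
  exact mul_mem_orderIdeal_add (hF _) (hG _)

lemma prod {κ : Type*} (s : Finset κ) {F : κ → PowerSeries (MvPowerSeries σ R)}
    (hF : ∀ i ∈ s, IsGraded (F i)) : IsGraded (∏ i ∈ s, F i) :=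
  prod_induction _ _ (fun _ _ => mul) one hF

lemma geomSeries {x : MvPowerSeries σ R} (hx : x.constantCoeff = 0) :
    IsGraded (geomSeries x) := fun r => by
  rw [SkewCauchy.geomSeries, PowerSeries.coeff_mk]
  exact MvPowerSeries.le_order_pow_of_constantCoeff_eq_zero r hx

lemma linSeries {y : MvPowerSeries σ R} (hy : y.constantCoeff = 0) :
    IsGraded (linSeries y) := fun r => by
  rw [SkewCauchy.linSeries, map_add, PowerSeries.coeff_C_mul, PowerSeries.coeff_X]
  refine add_mem (one r) ?_
  split_ifs with hr
  · rw [hr, mul_one]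
    exact_mod_cast MvPowerSeries.one_le_order_iff_constCoeff_eq_zero.mpr hy
  · rw [mul_zero]
    exact zero_mem _

lemma superSeries {κ : Type*} [Fintype κ] {x y : κ → MvPowerSeries σ R}
    (hx : ∀ i, (x i).constantCoeff = 0) (hy : ∀ i, (y i).constantCoeff = 0) :
    IsGraded (superSeries x y) :=
  prod _ fun i _ => (geomSeries (hx i)).mul (linSeries (hy i))

lemma skewSchur_mem_orderIdeal (hF : IsGraded F) (α β : YoungDiagram) :
    skewSchur F α β ∈ orderIdeal σ R (α.card - β.card) := by
  set N := max (α.colLen 0) (β.colLen 0)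
  rw [skewSchur, Matrix.det_apply']
  refine sum_mem fun π _ => Ideal.mul_mem_left _ _ ?_
  refine orderIdeal_antitone ?_ (prod_mem_orderIdeal_sum univ fun i _ => hF.intCoeff_mem _)
  have hα : (∑ i, betaNumber N α (π i) : ℤ) = α.card + ∑ i : Fin N, ((N - 1 - i : ℕ) : ℤ) := by
    rw [Equiv.sum_comp π fun i => (betaNumber N α i : ℤ)]
    exact_mod_cast sum_betaNumber (le_max_left _ _)
  have hβ : (∑ i, betaNumber N β i : ℤ) = β.card + ∑ i : Fin N, ((N - 1 - i : ℕ) : ℤ) := by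
    exact_mod_cast sum_betaNumber (le_max_right _ _)
  have hsum : ∑ i, ((betaNumber N α (π i) : ℤ) - betaNumber N β i) = α.card - β.card := by
    rw [sum_sub_distrib, hα, hβ, add_sub_add_right_eq_sub]
  have hle : ∑ i, ((betaNumber N α (π i) : ℤ) - betaNumber N β i) ≤
      ((∑ i, ((betaNumber N α (π i) : ℤ) - betaNumber N β i).toNat : ℕ) : ℤ) := by
    rw [Nat.cast_sum]
    exact sum_le_sum fun i _ => Int.self_le_toNat _
  lia

lemma skewSchur_mem_orderIdeal_of_not_le_rectDiagram (hF : IsGraded F) {α ν : YoungDiagram}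
    {n d : ℕ} (hn : d + α.card ≤ n) (hν : ¬ ν ≤ rectDiagram n n) :
    skewSchur F ν α ∈ orderIdeal σ R d := by
  have := le_card_of_not_le_rectDiagram hν
  exact orderIdeal_antitone (by lia) (hF.skewSchur_mem_orderIdeal ν α)

end IsGraded

end OrderIdeal

section CauchyKernels

variable {σ R : Type*} [CommRing R]

/-- The sum of `s_{ν/β} s_{ν/α}` over all partitions `ν`, with the first factor specialized by `F`
and the second one by `H`, as a function of `α`. -/
noncomputable def upperSum (F H : PowerSeries (MvPowerSeries σ R)) (β α : YoungDiagram) :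
    MvPowerSeries σ R :=
  formalSum fun ν => skewSchur F ν β * skewSchur H ν α

/-- The skew Cauchy identity `∑ ν, s_{ν/β} s_{ν/α} = (p / q) ∑ ν, s_{α/ν} s_{β/ν}` for the
specializations `F` and `H`. The kernel is kept as a fraction so that inverting `F` just exchanges
`p` and `q`, over any commutative ring. -/
def HasCauchyKernel (F H : PowerSeries (MvPowerSeries σ R)) (p q : MvPowerSeries σ R) : Prop :=
  ∀ β, q • upperSum F H β = p • skewingOperator F (skewSchur H β)

variable {F G H : PowerSeries (MvPowerSeries σ R)} {p q p' q' : MvPowerSeries σ R}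

lemma skewSchur_mul_skewSchur_eq_zero (F H : PowerSeries (MvPowerSeries σ R))
    {α ν : YoungDiagram} (β : YoungDiagram) (hν : ν ∉ Iic α) :
    skewSchur F α ν * skewSchur H β ν = 0 := by
  rw [skewSchur_eq_zero (mt mem_Iic.mpr hν), zero_mul]

lemma formallySummable_skewSchur_mul_skewSchur (F H : PowerSeries (MvPowerSeries σ R))
    (α β : YoungDiagram) : FormallySummable fun ν => skewSchur F α ν * skewSchur H β ν :=
  formallySummable_of_forall_exists_finset fun _ => ⟨Iic α, fun _ hν =>
    (skewSchur_mul_skewSchur_eq_zero F H β hν).symm ▸ zero_mem _⟩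

lemma formalSum_skewSchur_mul_skewSchur (F H : PowerSeries (MvPowerSeries σ R))
    (α β : YoungDiagram) :
    formalSum (fun ν => skewSchur F α ν * skewSchur H β ν) =
      skewingOperator F (skewSchur H β) α :=
  formalSum_eq_sum fun _ => skewSchur_mul_skewSchur_eq_zero F H β

lemma skewingOperator_skewSchur_comm (F H : PowerSeries (MvPowerSeries σ R))
    (α β : YoungDiagram) :
    skewingOperator F (skewSchur H β) α = skewingOperator H (skewSchur F α) β := by
  simp only [← formalSum_skewSchur_mul_skewSchur, mul_comm]

lemma IsGraded.skewSchur_mul_skewSchur_mem_orderIdeal (hH : IsGraded H)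
    (F : PowerSeries (MvPowerSeries σ R)) {α ν : YoungDiagram} (β : YoungDiagram) {n d : ℕ}
    (hn : d + α.card ≤ n) (hν : ν ∉ Iic (rectDiagram n n)) :
    skewSchur F ν β * skewSchur H ν α ∈ orderIdeal σ R d :=
  Ideal.mul_mem_left _ _
    (hH.skewSchur_mem_orderIdeal_of_not_le_rectDiagram hn (mt mem_Iic.mpr hν))

lemma IsGraded.formallySummable_skewSchur_mul_skewSchur (hH : IsGraded H)
    (F : PowerSeries (MvPowerSeries σ R)) (α β : YoungDiagram) :
    FormallySummable fun ν => skewSchur F ν β * skewSchur H ν α :=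
  formallySummable_of_forall_exists_finset fun _ => ⟨_, fun _ =>
    hH.skewSchur_mul_skewSchur_mem_orderIdeal F β le_rfl⟩

lemma IsGraded.upperSum_smodEq (hH : IsGraded H) (F : PowerSeries (MvPowerSeries σ R))
    {α : YoungDiagram} (β : YoungDiagram) {n d : ℕ} (hn : d + α.card ≤ n) :
    upperSum F H β α ≡ ∑ ν ∈ Iic (rectDiagram n n), skewSchur F ν β * skewSchur H ν α
      [SMOD orderIdeal σ R d] :=
  formalSum_smodEq_sum fun _ => hH.skewSchur_mul_skewSchur_mem_orderIdeal F β hn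

lemma upperSum_comm (F H : PowerSeries (MvPowerSeries σ R)) (α β : YoungDiagram) :
    upperSum F H β α = upperSum H F α β := by
  simp only [upperSum, mul_comm]

lemma upperSum_one (H : PowerSeries (MvPowerSeries σ R)) (β : YoungDiagram) :
    upperSum 1 H β = skewSchur H β := by
  ext1 α
  rw [upperSum, formalSum_eq_sum (s := {β}) fun ν hν => by
    rw [skewSchur_one_of_ne (mt mem_singleton.mpr hν), zero_mul], sum_singleton,
    skewSchur_one_self, one_mul]

lemma sum_Iic_skewSchur_mul_mul_skewSchur (hF : PowerSeries.constantCoeff F = 1)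
    (hG : PowerSeries.constantCoeff G = 1) (H : PowerSeries (MvPowerSeries σ R))
    (α β γ : YoungDiagram) :
    ∑ ν ∈ Iic γ, skewSchur (F * G) ν β * skewSchur H ν α =
      ∑ ρ ∈ Iic γ, skewSchur G ρ β * ∑ ν ∈ Iic γ, skewSchur F ν ρ * skewSchur H ν α := by
  simp only [mul_sum]
  rw [sum_comm]
  refine sum_congr rfl fun ν hν => ?_
  rw [skewSchur_mul hF hG, sum_Iic_skewSchur_mul_of_le F (skewSchur G · β) (mem_Iic.mp hν),
    sum_mul]
  exact sum_congr rfl fun ρ _ => by ring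

namespace HasCauchyKernel

lemma symm (h : HasCauchyKernel F H p q) : HasCauchyKernel H F p q := fun α => by
  ext1 β
  have hβ := congrFun (h β) α
  rwa [Pi.smul_apply, Pi.smul_apply, upperSum_comm, skewingOperator_skewSchur_comm] at hβ

lemma one (H : PowerSeries (MvPowerSeries σ R)) : HasCauchyKernel 1 H 1 1 := fun β => by
  rw [upperSum_one, skewingOperator_one, Module.End.one_apply]

lemma upperSum_mul (h : HasCauchyKernel F H p q) (hH : IsGraded H)
    (hF : PowerSeries.constantCoeff F = 1) (hG : PowerSeries.constantCoeff G = 1)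
    (β : YoungDiagram) :
    q • upperSum (F * G) H β = p • skewingOperator F (upperSum G H β) := by
  ext1 α
  refine eq_of_forall_smodEq_orderIdeal fun d => ?_
  set P := Iic (rectDiagram (d + α.card) (d + α.card))
  have hsum : ∀ ρ, q * upperSum F H ρ α = p * ∑ τ ∈ Iic α, skewSchur F α τ * skewSchur H ρ τ :=
    fun ρ => congrFun (h ρ) α
  calc q * upperSum (F * G) H β α
      ≡ q * ∑ ν ∈ P, skewSchur (F * G) ν β * skewSchur H ν α [SMOD orderIdeal σ R d] :=
        SModEq.rfl.mul (hH.upperSum_smodEq _ β le_rfl)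
    _ = ∑ ρ ∈ P, skewSchur G ρ β * (q * ∑ ν ∈ P, skewSchur F ν ρ * skewSchur H ν α) := by
        rw [sum_Iic_skewSchur_mul_mul_skewSchur hF hG, mul_sum]
        simp only [P, mul_left_comm q]
    _ ≡ ∑ ρ ∈ P, skewSchur G ρ β * (q * upperSum F H ρ α) [SMOD orderIdeal σ R d] :=
        SModEq.sum fun ρ _ =>
          SModEq.rfl.mul (SModEq.rfl.mul (hH.upperSum_smodEq F ρ le_rfl).symm)
    _ = p * ∑ τ ∈ Iic α, skewSchur F α τ * ∑ ρ ∈ P, skewSchur G ρ β * skewSchur H ρ τ := by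
        simp only [hsum, mul_sum]
        rw [sum_comm]
        exact sum_congr rfl fun τ _ => sum_congr rfl fun ρ _ => by ring
    _ ≡ p * ∑ τ ∈ Iic α, skewSchur F α τ * upperSum G H β τ [SMOD orderIdeal σ R d] := by
        refine SModEq.rfl.mul (SModEq.sum fun τ hτ => SModEq.rfl.mul ?_)
        have hτα : τ ≤ α := mem_Iic.mp hτ
        exact (hH.upperSum_smodEq G β (Nat.add_le_add_left (card_le_card hτα) d)).symm

lemma mul (hFH : HasCauchyKernel F H p q) (hGH : HasCauchyKernel G H p' q') (hH : IsGraded H)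
    (hF : PowerSeries.constantCoeff F = 1) (hG : PowerSeries.constantCoeff G = 1) :
    HasCauchyKernel (F * G) H (p * p') (q * q') := fun β => by
  calc (q * q') • upperSum (F * G) H β
      = q' • p • skewingOperator F (upperSum G H β) := by
        rw [mul_comm, mul_smul, hFH.upperSum_mul hH hF hG]
    _ = p • skewingOperator F (p' • skewingOperator G (skewSchur H β)) := by
        rw [smul_comm, ← map_smul, hGH β]
    _ = (p * p') • skewingOperator (F * G) (skewSchur H β) := by
        rw [map_smul, smul_smul, skewingOperator_mul hF hG, Module.End.mul_apply]

lemma of_mul_eq_one (h : HasCauchyKernel F H p q) (hH : IsGraded H)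
    (hF : PowerSeries.constantCoeff F = 1) (hG : PowerSeries.constantCoeff G = 1)
    (hGF : G * F = 1) : HasCauchyKernel G H q p := fun β => by
  have hskew : q • skewSchur H β = p • skewingOperator F (upperSum G H β) := by
    rw [← h.upperSum_mul hH hF hG, mul_comm F, hGF, upperSum_one]
  rw [← map_smul, hskew, map_smul, ← Module.End.mul_apply, ← skewingOperator_mul hG hF, hGF,
    skewingOperator_one, Module.End.one_apply]

lemma prod {ι : Type*} (s : Finset ι) {F : ι → PowerSeries (MvPowerSeries σ R)}
    {p q : ι → MvPowerSeries σ R} (h : ∀ i ∈ s, HasCauchyKernel (F i) H (p i) (q i))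
    (hH : IsGraded H) (hF : ∀ i ∈ s, PowerSeries.constantCoeff (F i) = 1) :
    HasCauchyKernel (∏ i ∈ s, F i) H (∏ i ∈ s, p i) (∏ i ∈ s, q i) := by
  induction s using Finset.cons_induction with
  | empty => exact one H
  | cons i s hi ih =>
    simp only [forall_mem_cons] at h hF
    simp only [prod_cons]
    exact h.1.mul (ih h.2 hF.2) hH hF.1 (by rw [map_prod, prod_eq_one hF.2])

lemma linSeries_geomSeries (y : MvPowerSeries σ R) {z : MvPowerSeries σ R}
    (hz : z.constantCoeff = 0) : HasCauchyKernel (linSeries y) (geomSeries z) (1 + y * z) 1 := by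
  refine fun β => funext fun α => eq_of_forall_smodEq_orderIdeal fun d => ?_
  obtain ⟨N, hN⟩ : ∃ N, N = d + α.card + α.colLen 0 + β.colLen 0 + β.rowLen 0 := ⟨_, rfl⟩
  rw [one_smul]
  refine ((IsGraded.geomSeries hz).upperSum_smodEq _ β (n := N + 1) (by lia)).trans ?_
  rw [sum_rectDiagram_skewSchur_linSeries_mul_skewSchur_geomSeries y z (by lia) (by lia) (by lia)]
  rfl

lemma geomSeries_of_linSeries_neg {x : MvPowerSeries σ R}
    (h : HasCauchyKernel (linSeries (-x)) H p q) (hH : IsGraded H) :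
    HasCauchyKernel (geomSeries x) H q p :=
  h.of_mul_eq_one hH (constantCoeff_linSeries _) (constantCoeff_geomSeries _)
    ((mul_comm _ _).trans (linSeries_neg_mul_geomSeries x))

lemma linSeries_of_geomSeries_neg {y : MvPowerSeries σ R}
    (h : HasCauchyKernel (geomSeries (-y)) H p q) (hH : IsGraded H) :
    HasCauchyKernel (linSeries y) H q p :=
  h.of_mul_eq_one hH (constantCoeff_geomSeries _) (constantCoeff_linSeries _)
    (by simpa only [neg_neg] using linSeries_neg_mul_geomSeries (-y))

variable {x y z w : MvPowerSeries σ R}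

lemma geomSeries_geomSeries (x : MvPowerSeries σ R) (hz : z.constantCoeff = 0) :
    HasCauchyKernel (geomSeries x) (geomSeries z) 1 (1 - x * z) := by
  simpa only [neg_mul, ← sub_eq_add_neg] using
    (linSeries_geomSeries (-x) hz).geomSeries_of_linSeries_neg (IsGraded.geomSeries hz)

lemma geomSeries_linSeries (hx : x.constantCoeff = 0) (w : MvPowerSeries σ R) :
    HasCauchyKernel (geomSeries x) (linSeries w) (1 + x * w) 1 := by
  simpa only [mul_comm] using (linSeries_geomSeries w hx).symm

lemma linSeries_linSeries (hy : y.constantCoeff = 0) (hw : w.constantCoeff = 0) :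
    HasCauchyKernel (linSeries y) (linSeries w) 1 (1 - y * w) := by
  have hy' : (-y).constantCoeff = 0 := by rw [map_neg, hy, neg_zero]
  simpa only [neg_mul, ← sub_eq_add_neg] using
    (geomSeries_linSeries hy' w).linSeries_of_geomSeries_neg (IsGraded.linSeries hw)

lemma geomSeries_mul_linSeries (hx : x.constantCoeff = 0) (hy : y.constantCoeff = 0)
    (hz : z.constantCoeff = 0) (hw : w.constantCoeff = 0) :
    HasCauchyKernel (geomSeries x * linSeries y) (geomSeries z * linSeries w)
      ((1 + x * w) * (1 + y * z)) ((1 - x * z) * (1 - y * w)) := by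
  have hxy := (IsGraded.geomSeries hx).mul (IsGraded.linSeries hy)
  have hgeom : HasCauchyKernel (geomSeries x * linSeries y) (geomSeries z) (1 + y * z)
      (1 - x * z) := by
    simpa only [one_mul, mul_one] using (geomSeries_geomSeries x hz).mul
      (linSeries_geomSeries y hz) (IsGraded.geomSeries hz) (by simp) (by simp)
  have hlin : HasCauchyKernel (geomSeries x * linSeries y) (linSeries w) (1 + x * w)
      (1 - y * w) := by
    simpa only [one_mul, mul_one] using (geomSeries_linSeries hx w).mul
      (linSeries_linSeries hy hw) (IsGraded.linSeries hw) (by simp) (by simp)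
  rw [mul_comm (1 + x * w)]
  exact (hgeom.symm.mul hlin.symm hxy (by simp) (by simp)).symm

lemma superSeries {ι κ : Type*} [Fintype ι] [Fintype κ] {x y : ι → MvPowerSeries σ R}
    {z w : κ → MvPowerSeries σ R} (hx : ∀ i, (x i).constantCoeff = 0)
    (hy : ∀ i, (y i).constantCoeff = 0) (hz : ∀ j, (z j).constantCoeff = 0)
    (hw : ∀ j, (w j).constantCoeff = 0) :
    HasCauchyKernel (superSeries x y) (superSeries z w)
      (∏ i, ∏ j, (1 + x i * w j) * (1 + y i * z j))
      (∏ i, ∏ j, (1 - x i * z j) * (1 - y i * w j)) :=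
  prod univ (fun i _ => (prod univ
      (fun j _ => (geomSeries_mul_linSeries (hx i) (hy i) (hz j) (hw j)).symm)
      ((IsGraded.geomSeries (hx i)).mul (IsGraded.linSeries (hy i))) (by simp)).symm)
    (IsGraded.superSeries hz hw) (by simp)

end HasCauchyKernel

end CauchyKernels

lemma eq_prod_mul_inv_mul_of_prod_mul_eq_prod_mul {σ K ι : Type*} [Field K] (s : Finset ι)
    {a b : ι → MvPowerSeries σ K} {f g : MvPowerSeries σ K}
    (hb : ∀ i ∈ s, (b i).constantCoeff ≠ 0) (h : (∏ i ∈ s, b i) * f = (∏ i ∈ s, a i) * g) :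
    f = (∏ i ∈ s, a i * (b i)⁻¹) * g := by
  have hinv : (∏ i ∈ s, (b i)⁻¹) * ∏ i ∈ s, b i = 1 := by
    rw [← prod_mul_distrib]
    exact prod_eq_one fun i hi => MvPowerSeries.inv_mul_cancel _ (hb i hi)
  calc f = (∏ i ∈ s, (b i)⁻¹) * ((∏ i ∈ s, b i) * f) := by rw [← mul_assoc, hinv, one_mul]
    _ = (∏ i ∈ s, a i * (b i)⁻¹) * g := by rw [h, prod_mul_distrib]; ring

end SkewCauchy

open SkewCauchy

theorem mainTheorem10_general {σ R : Type*} [CommRing R] {n m : ℕ}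
    {x y : Fin n → MvPowerSeries σ R} {z w : Fin m → MvPowerSeries σ R}
    (hx : ∀ i, (x i).constantCoeff = 0) (hy : ∀ i, (y i).constantCoeff = 0)
    (hz : ∀ j, (z j).constantCoeff = 0) (hw : ∀ j, (w j).constantCoeff = 0)
    (α β : YoungDiagram) :
    FormallySummable (fun ν => superSchur α ν x y * superSchur β ν z w) ∧
    FormallySummable (fun ν => superSchur ν β x y * superSchur ν α z w) ∧
    (∏ i, ∏ j, (1 + x i * w j) * (1 + y i * z j)) *
        formalSum (fun ν => superSchur α ν x y * superSchur β ν z w) =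
      (∏ i, ∏ j, (1 - x i * z j) * (1 - y i * w j)) *
        formalSum (fun ν => superSchur ν β x y * superSchur ν α z w) := by
  simp only [superSchur_eq_skewSchur]
  refine ⟨formallySummable_skewSchur_mul_skewSchur _ _ α β,
    (IsGraded.superSeries hz hw).formallySummable_skewSchur_mul_skewSchur _ α β, ?_⟩
  rw [formalSum_skewSchur_mul_skewSchur]
  exact (congrFun (HasCauchyKernel.superSeries hx hy hz hw β) α).symm

theorem mainTheorem10 (n m : ℕ) (α β : YoungDiagram) :
    FormallySummable (fun ν : YoungDiagram =>
      superSchur α ν (xVar n m) (yVar n m) * superSchur β ν (zVar n m) (wVar n m)) ∧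
    FormallySummable (fun ν : YoungDiagram =>
      superSchur ν β (xVar n m) (yVar n m) * superSchur ν α (zVar n m) (wVar n m)) ∧
    formalSum (fun ν : YoungDiagram =>
      superSchur α ν (xVar n m) (yVar n m) * superSchur β ν (zVar n m) (wVar n m)) =
    (∏ i : Fin n, ∏ j : Fin m,
      ((1 - xVar n m i * zVar n m j) * (1 - yVar n m i * wVar n m j)) *
        ((1 + xVar n m i * wVar n m j) * (1 + yVar n m i * zVar n m j))⁻¹) *
    formalSum (fun ν : YoungDiagram =>
      superSchur ν β (xVar n m) (yVar n m) * superSchur ν α (zVar n m) (wVar n m)) := by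
  have hX (v : CauchyVar n m) : (MvPowerSeries.X v : CauchySeries n m).constantCoeff = 0 :=
    MvPowerSeries.constantCoeff_X v
  obtain ⟨hlower, hupper, hcauchy⟩ := mainTheorem10_general (fun i => hX (.x i))
    (fun i => hX (.y i)) (fun j => hX (.z j)) (fun j => hX (.w j)) α β
  refine ⟨hlower, hupper, ?_⟩
  simp only [← Fintype.prod_prod_type'] at hcauchy ⊢
  exact eq_prod_mul_inv_mul_of_prod_mul_eq_prod_mul _ (by simp [xVar, yVar, hX]) hcauchy
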